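/- Let $E$ be a (real) Banach lattice. A net $(x_\alpha)$ in $E$ is said to be $un$-convergent to $0$ ($x_\alpha\xrightarrow{un}0$) if $\big\||x_\alpha|\wedge u\big\|\to 0$ for every $u\in E_+$, and $uaw$-convergent to $0$ ($x_\alpha\xrightarrow{uaw}0$) if $|x_\alpha|\wedge u\to 0$ in the weak topology of $E$ for every $u\in E_+$. Then the following are equivalent: (i) $E$ is order continuous, that is, $\|x_\alpha\|\to 0$ for every net $(x_\alpha)$ in $E$ with $x_\alpha\downarrow 0$ (decreasing with infimum $0$); (ii) for every net $(x_\alpha)$ in $E$, $x_\alpha\xrightarrow{uaw}0$ if and only if $x_\alpha\xrightarrow{un}0$; (iii) for every sequence $(x_n)$ in $E$, $x_n\xrightarrow{uaw}0$ if and only if $x_n\xrightarrow{un}0$. -/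

import Mathlib

open Filter Topology

universe u v

/-- The norm of `E` is order continuous (`E` is order continuous): for every net `x_i ↓ 0`
(decreasing, with infimum `0`) one has `‖x_i‖ → 0`. Index sets from the universe of `E` suffice,
since a decreasing net may be replaced by its range, a downward directed subset of `E`. -/
def IsOrderContinuousNorm (E : Type u) [NormedAddCommGroup E] [Lattice E] : Prop :=
  ∀ (ι : Type u) [Preorder ι] [IsDirectedOrder ι] [Nonempty ι] (x : ι → E),
    Antitone x → IsGLB (Set.range x) 0 → Tendsto (fun i => ‖x i‖) atTop (𝓝 0)

/-- Unbounded norm convergence (un-convergence) of a net `x` to `a`: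
`‖|x_i - a| ∧ w‖ → 0` for every `w ≥ 0`. -/
def UnTendsto {E : Type u} [NormedAddCommGroup E] [Lattice E]
    {ι : Type v} [Preorder ι] (x : ι → E) (a : E) : Prop :=
  ∀ w : E, 0 ≤ w → Tendsto (fun i => ‖|x i - a| ⊓ w‖) atTop (𝓝 0)

/-- Unbounded absolute weak convergence (uaw-convergence) of a net `x` to `a`:
`|x_i - a| ∧ w → 0` in the weak topology for every `w ≥ 0`. -/
def UawTendsto {E : Type u} [NormedAddCommGroup E] [NormedSpace ℝ E] [Lattice E]
    {ι : Type v} [Preorder ι] (x : ι → E) (a : E) : Prop :=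
  ∀ w : E, 0 ≤ w → Tendsto (fun i => toWeakSpace ℝ E (|x i - a| ⊓ w)) atTop (𝓝 0)

/-! Norm convergence implies weak convergence, so two implications carry the content. Under order
continuity, suppose a weakly null net in `[0, w]` is not norm null. Inductively choose terms `y n`
of norm at least `ε`, with norming positive functionals `φ n` almost vanishing on later terms. The
tail suprema `s n` of `y` exist and form a decreasing Cauchy sequence, yet `φ n (s n - s (n + 1)) ≥
ε / 2` (`not_almost_biorthogonal`). Conversely, a decreasing positive net that is not Cauchy yields
positive differences of norm at least `ε` with order bounded partial sums. These are uaw-null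
(`uawTendsto_zero_of_sum_le`), and being order bounded they cannot be un-null. -/

theorem tendsto_toWeakSpace_iff {E : Type*} [NormedAddCommGroup E] [NormedSpace ℝ E]
    {α : Type*} {l : Filter α} {f : α → E} {a : E} :
    Tendsto (fun i => toWeakSpace ℝ E (f i)) l (𝓝 (toWeakSpace ℝ E a)) ↔
      ∀ φ : StrongDual ℝ E, Tendsto (fun i => φ (f i)) l (𝓝 (φ a)) := by
  have hind : Topology.IsInducing fun (x : WeakSpace ℝ E) (φ : StrongDual ℝ E) =>
      φ ((toWeakSpace ℝ E).symm x) := ⟨rfl⟩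
  exact hind.tendsto_nhds_iff.trans tendsto_pi_nhds

section BanachLattice

variable {E : Type u} [NormedAddCommGroup E] [NormedSpace ℝ E] [Lattice E]
  [IsOrderedAddMonoid E] [IsOrderedModule ℝ E] [HasSolidNorm E]

omit [NormedSpace ℝ E] [IsOrderedModule ℝ E] in
theorem norm_le_norm_of_nonneg_of_le {x y : E} (hx : 0 ≤ x) (hxy : x ≤ y) : ‖x‖ ≤ ‖y‖ :=
  norm_le_norm_of_abs_le_abs (by rwa [abs_of_nonneg hx, abs_of_nonneg (hx.trans hxy)])

omit [IsOrderedAddMonoid E] [HasSolidNorm E] in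
theorem posPart_smul_of_pos {c : ℝ} (hc : 0 < c) (x : E) : (c • x)⁺ = c • x⁺ := by
  have := (OrderIso.smulRight (β := E) hc).map_sup x 0
  rw [OrderIso.smulRight_apply, OrderIso.smulRight_apply, OrderIso.smulRight_apply,
    smul_zero] at this
  exact this.symm

/-! ### Positive norming functionals -/

/-- Every positive vector is normed by a positive functional of norm at most one. -/
theorem exists_nonneg_functional_apply_eq_norm {y : E} (hy : 0 ≤ y) :
    ∃ φ : StrongDual ℝ E, (∀ x, 0 ≤ x → 0 ≤ φ x) ∧ (∀ x, φ x ≤ ‖x‖) ∧ φ y = ‖y‖ := by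
  rcases eq_or_ne y 0 with rfl | hy0
  · exact ⟨0, by simp, by simp, by simp⟩
  have hpos (x : E) : ‖x⁺‖ ≤ ‖x‖ := by
    refine norm_le_norm_of_abs_le_abs ?_
    rw [abs_of_nonneg (posPart_nonneg x)]
    exact sup_le (le_abs_self x) (abs_nonneg x)
  -- Dominating by `‖x⁺‖` rather than `‖x‖` forces positivity: the bound vanishes on negative
  -- vectors.
  obtain ⟨g, hg, hgle⟩ := exists_extension_of_le_sublinear
    (LinearPMap.mkSpanSingleton y ‖y‖ hy0) (fun x : E => ‖x⁺‖)
    (fun c hc x => by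
      rw [posPart_smul_of_pos hc, norm_smul, Real.norm_of_nonneg hc.le])
    (fun x z => by
      refine (norm_le_norm_of_nonneg_of_le (posPart_nonneg _) ?_).trans (norm_add_le x⁺ z⁺)
      exact sup_le (add_le_add (le_posPart x) (le_posPart z))
        (add_nonneg (posPart_nonneg x) (posPart_nonneg z)))
    (by
      rintro ⟨x, hx⟩
      obtain ⟨c, rfl⟩ := Submodule.mem_span_singleton.1 hx
      rw [LinearPMap.mkSpanSingleton'_apply, RingHom.id_apply]
      rcases le_or_gt c 0 with hc | hc
      · exact (smul_nonpos_of_nonpos_of_nonneg hc (norm_nonneg y)).trans (norm_nonneg _)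
      · change c • ‖y‖ ≤ ‖(c • y)⁺‖
        rw [posPart_smul_of_pos hc, posPart_of_nonneg hy, norm_smul, Real.norm_of_nonneg hc.le,
          smul_eq_mul])
  have hgnorm (x : E) : g x ≤ ‖x‖ := (hgle x).trans (hpos x)
  refine ⟨g.mkContinuous 1 fun x => ?_, fun x hx => ?_, hgnorm, ?_⟩
  · rw [one_mul, Real.norm_eq_abs, abs_le]
    refine ⟨?_, hgnorm x⟩
    have := hgnorm (-x)
    rw [map_neg, norm_neg] at this
    linarith
  · have := hgle (-x)
    rw [posPart_of_nonpos (neg_nonpos.2 hx), norm_zero, map_neg] at this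
    exact neg_nonpos.1 this
  · change g y = ‖y‖
    exact (hg ⟨y, Submodule.mem_span_singleton_self y⟩).trans
      (LinearPMap.mkSpanSingleton_apply ℝ ℝ hy0 _)

omit [IsOrderedModule ℝ E] in
-- Weak nullity from order bounded sums
/-- A sequence of positive vectors with order bounded partial sums is
absolutely summable against each functional. -/
theorem summable_abs_apply_of_sum_le {d : ℕ → E} {u : E} (hd : ∀ n, 0 ≤ d n)
    (hu : ∀ N, ∑ n ∈ Finset.range N, d n ≤ u) (φ : StrongDual ℝ E) :
    Summable fun n => |φ (d n)| := by
  refine summable_of_sum_range_le (c := ‖φ‖ * ‖u‖) (fun n => abs_nonneg _) fun N => ?_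
  -- Signs turn the sum of absolute values into `φ` of a single vector whose modulus is at most `u`.
  let s : ℕ → ℤ := fun n => if 0 ≤ φ (d n) then 1 else -1
  have habs (n : ℕ) : |φ (d n)| = φ (s n • d n) := by
    by_cases h : 0 ≤ φ (d n)
    · simp [s, h]
    · simp [s, h, abs_of_neg (not_le.1 h)]
  have hle (n : ℕ) : |s n • d n| ≤ d n := by
    by_cases h : 0 ≤ φ (d n) <;> simp [s, h, abs_of_nonneg (hd n)]
  have hsum : |∑ n ∈ Finset.range N, s n • d n| ≤ u := by
    refine le_trans ?_ (hu N)
    induction N with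
    | zero => simp
    | succ N ih =>
      rw [Finset.sum_range_succ, Finset.sum_range_succ]
      exact (abs_add_le _ _).trans (add_le_add ih (hle N))
  calc ∑ n ∈ Finset.range N, |φ (d n)| = φ (∑ n ∈ Finset.range N, s n • d n) := by
        rw [map_sum]; exact Finset.sum_congr rfl fun n _ => habs n
    _ ≤ ‖φ (∑ n ∈ Finset.range N, s n • d n)‖ := le_abs_self _
    _ ≤ ‖φ‖ * ‖∑ n ∈ Finset.range N, s n • d n‖ := φ.le_opNorm _
    _ ≤ ‖φ‖ * ‖u‖ := by
        gcongr
        exact norm_le_norm_of_abs_le_abs (hsum.trans (le_abs_self u))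

omit [IsOrderedModule ℝ E] in
theorem uawTendsto_zero_of_sum_le {d : ℕ → E} {u : E} (hd : ∀ n, 0 ≤ d n)
    (hu : ∀ N, ∑ n ∈ Finset.range N, d n ≤ u) : UawTendsto d 0 := by
  intro w hw
  rw [← map_zero (toWeakSpace ℝ E), tendsto_toWeakSpace_iff]
  intro φ
  have key := (summable_abs_apply_of_sum_le (d := fun n => d n ⊓ w) (u := u)
    (fun n => le_inf (hd n) hw)
    (fun N => (Finset.sum_le_sum fun n _ => inf_le_left).trans (hu N)) φ).tendsto_atTop_zero
  rw [map_zero]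
  simpa [abs_of_nonneg (hd _)] using (tendsto_zero_iff_abs_tendsto_zero _).2 key

omit [IsOrderedAddMonoid E] [IsOrderedModule ℝ E] [HasSolidNorm E] in
theorem UnTendsto.uawTendsto {ι : Type v} [Preorder ι] {x : ι → E} {a : E}
    (h : UnTendsto x a) : UawTendsto x a := by
  intro w hw
  have := ((toWeakSpaceCLM ℝ E).continuous.tendsto 0).comp (tendsto_zero_iff_norm_tendsto_zero.2
    (h w hw))
  rwa [map_zero] at this

/-! ### Consequences of order continuity -/

/-- A vector lying below every difference between an upper bound and a member of a family
is nonpositive. -/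
theorem nonpos_of_forall_le_upperBound_sub {ι : Type*} [Nonempty ι] {x : ι → E}
    (hx : BddAbove (Set.range x)) {z : E}
    (hz : ∀ v ∈ upperBounds (Set.range x), ∀ i, z ≤ v - x i) : z ≤ 0 := by
  obtain ⟨v, hv⟩ := hx
  obtain ⟨i₀⟩ := ‹Nonempty ι›
  -- Subtracting `z` preserves upper bounds, so it can be iterated; the Archimedean property then
  -- gives `z ≤ 0`.
  have hk (k : ℕ) : v - k • z ∈ upperBounds (Set.range x) := by
    induction k with
    | zero => simpa using hv
    | succ k ih =>
      rintro _ ⟨i, rfl⟩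
      have := hz _ ih i
      rw [succ_nsmul]
      rw [le_sub_comm] at this
      simpa [sub_sub] using this
  have hle (k : ℕ) : z ≤ ((k + 1 : ℕ) : ℝ)⁻¹ • (v - x i₀) := by
    have h : (k + 1) • z ≤ v - x i₀ := by
      rw [le_sub_comm]
      exact hk (k + 1) ⟨i₀, rfl⟩
    have hpos : (0 : ℝ) < ((k + 1 : ℕ) : ℝ) := by positivity
    rwa [le_inv_smul_iff_of_pos hpos, Nat.cast_smul_eq_nsmul]
  have hlim : Tendsto (fun k : ℕ => ((k + 1 : ℕ) : ℝ)⁻¹ • (v - x i₀)) atTop (𝓝 0) := by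
    have h : Tendsto (fun k : ℕ => ((k + 1 : ℕ) : ℝ)⁻¹) atTop (𝓝 0) :=
      tendsto_inv_atTop_zero.comp
        (tendsto_natCast_atTop_atTop.comp (tendsto_add_atTop_nat 1))
    simpa only [zero_smul] using h.smul_const (v - x i₀)
  exact ge_of_tendsto' hlim hle

/-- In an order continuous Banach lattice, order bounded increasing sequences are Cauchy. -/
theorem IsOrderContinuousNorm.cauchySeq_of_monotone (hE : IsOrderContinuousNorm E)
    {x : ℕ → E} (hx : Monotone x) (hb : BddAbove (Set.range x)) : CauchySeq x := by
  -- No supremum of `x` need exist, so the differences `v - x n` over all upper bounds `v` serve as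
  -- the net decreasing to `0`.
  let U := {v : E // v ∈ upperBounds (Set.range x)}
  have : Nonempty U := hb.to_subtype
  have hdir : IsDirectedOrder (Uᵒᵈ) :=
    ⟨fun v w => ⟨OrderDual.toDual ⟨(OrderDual.ofDual v).1 ⊓ (OrderDual.ofDual w).1, by
      rintro _ ⟨n, rfl⟩
      exact le_inf ((OrderDual.ofDual v).2 ⟨n, rfl⟩) ((OrderDual.ofDual w).2 ⟨n, rfl⟩)⟩,
      inf_le_left (a := (OrderDual.ofDual v).1), inf_le_right (a := (OrderDual.ofDual v).1)⟩⟩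
  let y : Uᵒᵈ × ℕ → E := fun p => (OrderDual.ofDual p.1).1 - x p.2
  have hdir' : IsDirectedOrder (Uᵒᵈ × ℕ) := ⟨fun p q => by
    obtain ⟨v, h1, h2⟩ := hdir.directed p.1 q.1
    exact ⟨(v, p.2 ⊔ q.2), ⟨h1, le_sup_left⟩, ⟨h2, le_sup_right⟩⟩⟩
  have hy : Antitone y := fun p q hpq => sub_le_sub hpq.1 (hx hpq.2)
  have hglb : IsGLB (Set.range y) 0 := by
    constructor
    · rintro _ ⟨p, rfl⟩
      exact sub_nonneg.2 ((OrderDual.ofDual p.1).2 ⟨p.2, rfl⟩)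
    · intro z hz
      exact nonpos_of_forall_le_upperBound_sub hb fun v hv n =>
        hz ⟨(OrderDual.toDual ⟨v, hv⟩, n), rfl⟩
  have hlim := hE _ y hy hglb
  refine Metric.cauchySeq_iff'.2 fun ε hε => ?_
  obtain ⟨⟨v, N⟩, hv⟩ := ((hlim.eventually (gt_mem_nhds hε))).exists
  refine ⟨N, fun n hn => ?_⟩
  rw [dist_eq_norm]
  refine lt_of_le_of_lt (norm_le_norm_of_nonneg_of_le (sub_nonneg.2 (hx hn)) ?_) hv
  exact sub_le_sub_right ((OrderDual.ofDual v).2 ⟨n, rfl⟩) _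

theorem IsOrderContinuousNorm.cauchySeq_of_antitone (hE : IsOrderContinuousNorm E)
    {x : ℕ → E} (hx : Antitone x) (hb : BddBelow (Set.range x)) : CauchySeq x := by
  obtain ⟨b, hb⟩ := hb
  have h := hE.cauchySeq_of_monotone (x := fun n => -x n) (fun m n h => neg_le_neg (hx h))
    ⟨-b, by rintro _ ⟨n, rfl⟩; exact neg_le_neg (hb ⟨n, rfl⟩)⟩
  have h' := h.neg
  rwa [show (-fun n => -x n) = x from funext fun n => neg_neg (x n)] at h'

omit [HasSolidNorm E] [IsOrderedModule ℝ E] in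
theorem apply_partialSups_le_sum {φ : StrongDual ℝ E} (hφ : ∀ x, 0 ≤ x → 0 ≤ φ x)
    {y : ℕ → E} (hy : ∀ n, 0 ≤ y n) (m : ℕ) :
    φ (partialSups y m) ≤ ∑ k ∈ Finset.range (m + 1), φ (y k) := by
  rw [← map_sum, ← sub_nonneg, ← map_sub]
  refine hφ _ (sub_nonneg.2 (partialSups_le _ _ _ fun k hk => ?_))
  exact Finset.single_le_sum (f := y) (fun i _ => hy i) (Finset.mem_range.2 (by omega))

/-- In an order continuous Banach lattice there is no sequence in an order interval that is
normed by positive contractions nearly vanishing on all later terms. -/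
theorem IsOrderContinuousNorm.not_almost_biorthogonal [CompleteSpace E]
    (hE : IsOrderContinuousNorm E) {y : ℕ → E} {w : E} {ε : ℝ} (hε : 0 < ε)
    (hy : ∀ n, 0 ≤ y n) (hyw : ∀ n, y n ≤ w) {φ : ℕ → StrongDual ℝ E}
    (hφ : ∀ n x, 0 ≤ x → 0 ≤ φ n x) (hφ1 : ∀ n x, φ n x ≤ ‖x‖) (hφy : ∀ n, ε ≤ φ n (y n))
    (hlate : ∀ m n, m < n → φ m (y n) ≤ ε / 4 * (1 / 2) ^ n) : False := by
  -- As `m` grows, `σ n m` increases to the supremum of the tail from `n`.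
  let σ : ℕ → ℕ → E := fun n => partialSups fun k => y (n + k)
  have hσw (n m : ℕ) : σ n m ≤ w := partialSups_le _ _ _ fun k _ => hyw _
  have hmono (n : ℕ) : Monotone (σ n) := partialSups_monotone _
  have hlim (n : ℕ) : ∃ s, Tendsto (σ n) atTop (𝓝 s) :=
    cauchySeq_tendsto_of_complete (hE.cauchySeq_of_monotone (hmono n)
      ⟨w, by rintro _ ⟨m, rfl⟩; exact hσw n m⟩)
  choose s hs using hlim
  have hσs (n m : ℕ) : σ n m ≤ s n := (hmono n).ge_of_tendsto (hs n) m
  have hys (n : ℕ) : y n ≤ s n := by simpa [σ] using hσs n 0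
  have hanti : Antitone s := antitone_nat_of_succ_le fun n => by
    refine le_of_tendsto' (hs (n + 1)) fun m => (partialSups_le _ _ _ fun k hk => ?_).trans
      (hσs n (m + 1))
    have h := le_partialSups_of_le (fun k => y (n + k)) (Nat.succ_le_succ hk)
    rwa [show n + Nat.succ k = n + 1 + k by omega] at h
  have hsmall (n : ℕ) : φ n (s (n + 1)) ≤ ε / 2 := by
    refine le_of_tendsto' (((φ n).continuous.tendsto _).comp (hs (n + 1))) fun m => ?_
    refine (apply_partialSups_le_sum (hφ n) (fun k => hy _) m).trans ?_
    calc ∑ k ∈ Finset.range (m + 1), φ n (y (n + 1 + k))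
        ≤ ∑ k ∈ Finset.range (m + 1), ε / 4 * (1 / 2) ^ k := by
          refine Finset.sum_le_sum fun k _ => (hlate n _ (by omega)).trans ?_
          gcongr ε / 4 * ?_
          exact pow_le_pow_of_le_one (by norm_num) (by norm_num) (by omega)
      _ ≤ ε / 4 * 2 := by
          rw [← Finset.mul_sum]
          gcongr
          exact sum_geometric_two_le _
      _ = ε / 2 := by ring
  have hc : CauchySeq s := hE.cauchySeq_of_antitone hanti
    ⟨0, by rintro _ ⟨n, rfl⟩; exact (hy n).trans (hys n)⟩
  obtain ⟨N, hN⟩ := Metric.cauchySeq_iff'.1 hc (ε / 2) (half_pos hε)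
  have h1 := hN (N + 1) (by omega)
  rw [dist_comm, dist_eq_norm] at h1
  have h2 := hφ1 N (s N - s (N + 1))
  have h3 := hφ N _ (sub_nonneg.2 (hys N))
  rw [map_sub] at h2 h3
  linarith [hsmall N, hφy N]

/-- In an order continuous Banach lattice, a weakly null net in an order interval `[0, w]` is
norm null. -/
theorem IsOrderContinuousNorm.tendsto_norm_of_weakly_null [CompleteSpace E]
    (hE : IsOrderContinuousNorm E) {α : Type*} {l : Filter α} {y : α → E} {w : E}
    (hy : ∀ i, 0 ≤ y i) (hyw : ∀ i, y i ≤ w)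
    (hweak : ∀ φ : StrongDual ℝ E, Tendsto (fun i => φ (y i)) l (𝓝 0)) :
    Tendsto (fun i => ‖y i‖) l (𝓝 0) := by
  rw [← tendsto_zero_iff_norm_tendsto_zero]
  by_contra hnot
  simp only [Metric.tendsto_nhds, not_forall, Filter.not_eventually, not_lt] at hnot
  obtain ⟨ε, hε, hfreq⟩ := hnot
  simp only [dist_zero_right] at hfreq
  choose φ hφ hφ1 hφy using fun i => exists_nonneg_functional_apply_eq_norm (hy i)
  -- The natural number paired with each index strictly increases along the sequence, so it is at
  -- least `n` at stage `n` and fixes the tolerance.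
  obtain ⟨g, hgP, hgr⟩ := exists_seq_of_forall_finset_exists
    (fun p : ℕ × α => ε ≤ ‖y p.2‖)
    (fun p q => p.1 < q.1 ∧ φ p.2 (y q.2) ≤ ε / 4 * (1 / 2) ^ q.1) fun S _ => by
      let N := S.sup Prod.fst + 1
      have hev : ∀ᶠ i in l, ∀ p ∈ S, φ p.2 (y i) ≤ ε / 4 * (1 / 2) ^ N := by
        refine (Filter.eventually_all_finset S).2 fun p _ => ?_
        exact ((hweak (φ p.2)).eventually (gt_mem_nhds (by positivity))).mono fun i hi => hi.le
      obtain ⟨i, hi, hiS⟩ := (hfreq.and_eventually hev).exists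
      exact ⟨(N, i), hi, fun p hp =>
        ⟨Nat.lt_succ_of_le (Finset.le_sup (f := Prod.fst) hp), hiS p hp⟩⟩
  have hidx : StrictMono fun n => (g n).1 := strictMono_nat_of_lt_succ fun n =>
    (hgr n (n + 1) (Nat.lt_succ_self n)).1
  refine hE.not_almost_biorthogonal (y := fun n => y (g n).2) (φ := fun n => φ (g n).2) hε
    (fun n => hy _) (fun n => hyw _) (fun n => hφ _) (fun n => hφ1 _)
    (fun n => (hgP n).trans (hφy _).ge) fun m n hmn => (hgr m n hmn).2.trans ?_
  gcongr ε / 4 * ?_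
  exact pow_le_pow_of_le_one (by norm_num) (by norm_num) (hidx.le_apply (x := n))

theorem IsOrderContinuousNorm.unTendsto_zero [CompleteSpace E] (hE : IsOrderContinuousNorm E)
    {ι : Type v} [Preorder ι] {x : ι → E} (hx : UawTendsto x 0) : UnTendsto x 0 := by
  intro w hw
  refine hE.tendsto_norm_of_weakly_null (fun i => le_inf (abs_nonneg _) hw)
    (fun i => inf_le_right) fun φ => ?_
  have h := hx w hw
  rw [← map_zero (toWeakSpace ℝ E), tendsto_toWeakSpace_iff] at h
  simpa using h φ

/-! ### Recovering order continuity from sequences -/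

omit [IsOrderedModule ℝ E] in
/-- If uaw-null sequences are un-null, then decreasing nets with infimum zero are norm null. -/
theorem isOrderContinuousNorm_of_seq_unTendsto [CompleteSpace E]
    (h : ∀ x : ℕ → E, UawTendsto x 0 → UnTendsto x 0) : IsOrderContinuousNorm E := by
  intro ι _ _ _ x hx hglb
  have hx0 (i : ι) : 0 ≤ x i := hglb.1 ⟨i, rfl⟩
  have hcauchy : ∀ ε > 0, ∃ i, ∀ j, i ≤ j → ‖x i - x j‖ < ε := by
    by_contra! hnot
    obtain ⟨ε, hε, hnot⟩ := hnot
    choose g hg hgε using hnot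
    obtain ⟨i₀⟩ := ‹Nonempty ι›
    let a : ℕ → ι := fun n => g^[n] i₀
    have ha (n : ℕ) : a (n + 1) = g (a n) := Function.iterate_succ_apply' g n i₀
    let d : ℕ → E := fun n => x (a n) - x (a (n + 1))
    have hd (n : ℕ) : 0 ≤ d n := sub_nonneg.2 (hx ((hg (a n)).trans (ha n).ge))
    have hsum (N : ℕ) : ∑ n ∈ Finset.range N, d n ≤ x i₀ := by
      rw [Finset.sum_range_sub']
      exact sub_le_self _ (hx0 _)
    have hdle (n : ℕ) : d n ≤ x i₀ :=
      (Finset.single_le_sum (fun i _ => hd i) (Finset.self_mem_range_succ n)).trans (hsum (n + 1))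
    have hlim := h d (uawTendsto_zero_of_sum_le hd hsum) (x i₀) (hx0 i₀)
    obtain ⟨n, hn⟩ := (hlim.eventually (gt_mem_nhds hε)).exists
    rw [sub_zero, abs_of_nonneg (hd n), inf_eq_left.2 (hdle n)] at hn
    have h' := hgε (a n)
    rw [← ha n] at h'
    exact absurd hn (not_lt.2 h')
  have hc : Cauchy (map x atTop) := by
    refine Metric.cauchy_iff.2 ⟨inferInstance, fun ε hε => ?_⟩
    obtain ⟨i, hi⟩ := hcauchy (ε / 2) (half_pos hε)
    refine ⟨x '' Set.Ici i, image_mem_map (Ici_mem_atTop i), ?_⟩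
    rintro _ ⟨j, hj, rfl⟩ _ ⟨k, hk, rfl⟩
    have h1 := hi j hj
    have h2 := hi k hk
    rw [← dist_eq_norm] at h1 h2
    linarith [dist_triangle_left (x j) (x k) (x i)]
  obtain ⟨a, ha⟩ := CompleteSpace.complete hc
  have ha' : Tendsto x atTop (𝓝 a) := ha
  have : a = 0 := (isGLB_of_tendsto_atTop hx ha').unique hglb
  rw [← tendsto_zero_iff_norm_tendsto_zero]
  rwa [this] at ha'

end BanachLattice

/-- For a (real) Banach lattice `E`: order continuity, coincidence of uaw-null and un-null nets,
and coincidence of uaw-null and un-null sequences are equivalent. -/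
theorem mainTheorem3 (E : Type u) [NormedAddCommGroup E] [NormedSpace ℝ E] [Lattice E]
    [IsOrderedAddMonoid E] [IsOrderedModule ℝ E] [HasSolidNorm E] [CompleteSpace E] :
    List.TFAE [
      IsOrderContinuousNorm E,
      ∀ (ι : Type v) [Preorder ι] [IsDirectedOrder ι] [Nonempty ι] (x : ι → E),
        UawTendsto x 0 ↔ UnTendsto x 0,
      ∀ x : ℕ → E, UawTendsto x 0 ↔ UnTendsto x 0] := by
  tfae_have 1 → 2 := fun h ι _ _ _ x => ⟨h.unTendsto_zero, UnTendsto.uawTendsto⟩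
  tfae_have 2 → 3 := fun h x => by
    -- Lifting `ℕ` matches the universe of the index sets.
    have key := h (ULift.{v} ℕ) fun n => x n.down
    have hup : Tendsto (ULift.up.{v} : ℕ → ULift.{v} ℕ) atTop atTop :=
      tendsto_atTop.2 fun b => (eventually_ge_atTop b.down).mono fun n hn => hn
    have hdown : Tendsto (ULift.down.{v} : ULift.{v} ℕ → ℕ) atTop atTop :=
      tendsto_atTop.2 fun b => (eventually_ge_atTop (ULift.up b)).mono fun n hn => hn
    exact ⟨fun hx w hw => (key.1 (fun z hz => (hx z hz).comp hdown) w hw).comp hup,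
      UnTendsto.uawTendsto⟩
  tfae_have 3 → 1 := fun h => isOrderContinuousNorm_of_seq_unTendsto fun x => (h x).1
  tfae_finish
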